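/- Let $n\ge 1$, let $D^{2n}$ be the closed unit ball of $\mathbb R^{2n}$ with the standard symplectic form $\sum_{i=1}^n dq_i\wedge dp_i$. A symplectomorphism of $D^{2n}$ is a bijection $D^{2n}\to D^{2n}$ that is $C^\infty$ with $C^\infty$ inverse (up to the boundary) and preserves this form. Then for every neighborhood $\mathcal V$ of the trivial family $(t,x)\mapsto x$ in $C^\infty([0,1]\times D^{2n},\mathbb R^{2n})$ there is a neighborhood $\mathcal U$ of the identity in $C^\infty(D^{2n},\mathbb R^{2n})$ such that the following holds. For every symplectomorphism $\varphi_0$ of $D^{2n}$ that lies in $\mathcal U$ and equals the identity in a neighborhood of $\partial D^{2n}$, there is a family $\{\varphi_t\}_{t\in[0,1]}$ of symplectomorphisms of $D^{2n}$ such that 1. the map $(t,x)\mapsto\varphi_t(x)$ is $C^\infty$ on $[0,1]\times D^{2n}$; 2. there is a neighborhood of $\partial D^{2n}$ on which every $\varphi_t$, $t\in[0,1]$, is the identity; 3. $\varphi_t=\varphi_0$ for all $t\in[0,\frac13]$ and $\varphi_t=\mathrm{id}$ for all $t\in[\frac23,1]$; 4. the map $(t,x)\mapsto\varphi_t(x)$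 belongs to $\mathcal V$. Here the $C^\infty$ topologies are those of uniform convergence of all derivatives; for the family, derivatives in $(t,x)$ jointly. -/

import Mathlib

open Set Metric
open scoped ContDiff

noncomputable section

/-- The space `ℝ²ⁿ` with its Euclidean norm; `z (Sum.inl i)` is the coordinate `qᵢ` of `z` and
`z (Sum.inr i)` is the coordinate `pᵢ`. -/
abbrev PhaseSpace (n : ℕ) : Type := EuclideanSpace ℝ (Fin n ⊕ Fin n)

/-- The standard symplectic form `∑ dqᵢ ∧ dpᵢ` on `ℝ²ⁿ`. -/
def stdSymplecticForm {n : ℕ} (u v : PhaseSpace n) : ℝ :=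
  ∑ i, (u (Sum.inl i) * v (Sum.inr i) - u (Sum.inr i) * v (Sum.inl i))

/-- The closed unit disc `D²ⁿ` in `ℝ²ⁿ`. -/
def unitDisc (n : ℕ) : Set (PhaseSpace n) := closedBall 0 1

/-- The boundary of `D²ⁿ`. -/
def unitDiscBoundary (n : ℕ) : Set (PhaseSpace n) := sphere 0 1

/-- `φ` restricts to a symplectomorphism of the disc `D²ⁿ`: a `C^∞` bijection of the disc onto
itself with `C^∞` inverse (smooth up to the boundary) which preserves the standard symplectic
form. The values of `φ` outside the disc play no role. -/
structure IsDiscSymplectomorphism {n : ℕ} (φ : PhaseSpace n → PhaseSpace n) : Prop where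
  mapsTo : MapsTo φ (unitDisc n) (unitDisc n)
  contDiffOn : ContDiffOn ℝ ∞ φ (unitDisc n)
  exists_inverse : ∃ ψ : PhaseSpace n → PhaseSpace n,
    MapsTo ψ (unitDisc n) (unitDisc n) ∧ InvOn ψ φ (unitDisc n) (unitDisc n) ∧
      ContDiffOn ℝ ∞ ψ (unitDisc n)
  preserves_form : ∀ x ∈ unitDisc n, ∀ u v : PhaseSpace n,
    stdSymplecticForm (fderivWithin ℝ φ (unitDisc n) x u) (fderivWithin ℝ φ (unitDisc n) x v) =
      stdSymplecticForm u v

/-- `f` is `ε`-close to `g` on `K` in `C^k`: all derivatives of `f - g` of order at most `k` are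
smaller than `ε` at every point of `K`. For `K` compact (and the closure of its interior, convex)
the sets `{f | CkClose k ε K f g}`, `k : ℕ`, `ε > 0`, form a basis of neighbourhoods of `g` in
the `C^∞` topology on smooth maps on `K`. -/
def CkClose {E F : Type*} [NormedAddCommGroup E] [NormedSpace ℝ E]
    [NormedAddCommGroup F] [NormedSpace ℝ F] (k : ℕ) (ε : ℝ) (K : Set E) (f g : E → F) : Prop :=
  ∀ j ≤ k, ∀ x ∈ K, ‖iteratedFDerivWithin ℝ j (fun y => f y - g y) K x‖ < ε

end

/-!
The contraction comes from an explicit deformation, a symmetric version of the scaling of a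
generating function. Write `φ₀ = id + u`, with `u` extended by zero outside the disc, and
`F_c = id + c u`. If `u` is `C¹`-small, each `F_c` with `|c| ≤ 1` is a diffeomorphism of the whole
space that is the identity where `u` vanishes, hence preserves the disc. Put
`φ_t = F_{1 - σ t} ∘ (F_{σ t})⁻¹`, where `σ` is smooth, `σ = 0` for `t ≤ 1/3` and `σ = 1/2` for
`t ≥ 2/3`; then `φ_t` is `φ₀` for the former times and the identity for the latter.

*Symplecticity.* As `id + Du` is symplectic, `ω (Du a, b) + ω (a, Du b) = -ω (Du a, Du b)`, so
`F_c` pulls `ω` back to `ω - c (1 - c) ω (Du ·, Du ·)`. This is symmetric under `c ↔ 1 - c`, i.e.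
`F_c` and `F_{1 - c}` pull `ω` back to the same form (`stdSymplecticForm_add_one_sub_smul`), and
`F_{1 - c} ∘ F_c⁻¹` is symplectic. No primitive of a closed form is needed.

*Smoothness in `(t, x)`.* The inverses `G (t, ·)` of `F_{σ t}` exist because `c u` is a contraction,
and they depend smoothly on `(t, x)` by the inverse function theorem
(`exists_contDiff_inverse_add_smul`).

*Smallness.* The displacement of the family is `φ_t x - x = (1 - 2 σ t) u (G (t, x))`. The
space-time map `H (t, x) = (t, G (t, x))` is a right inverse of `id + v` for the small
`v (t, y) = (0, σ t u y)`, so `DH = id - (Dv ∘ H) DH`, and induction on the order bounds the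
derivatives of `H` by constants that depend only on the order
(`exists_norm_iteratedFDeriv_rightInverse_le`). The bounds on composites then make the displacement
as small as `u` (`exists_norm_iteratedFDeriv_smul_comp_inverse_lt`).
-/

open scoped Topology NNReal

/-! ### Estimates on higher derivatives -/

section Estimates

variable {E F : Type*} [NormedAddCommGroup E] [NormedSpace ℝ E]
  [NormedAddCommGroup F] [NormedSpace ℝ F]

/-- Multiplying `u y` by a fixed smooth function of the time `t ∈ [0, 1]` keeps `C^k`-smallness,
with a constant that does not depend on `u`. -/
theorem exists_norm_iteratedFDeriv_smul_snd_le {χ : ℝ → ℝ} (hχ : ContDiff ℝ ∞ χ) (k : ℕ) :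
    ∃ C : ℝ, 0 < C ∧ ∀ (u : E → F) (δ : ℝ), ContDiff ℝ ∞ u →
      (∀ j ≤ k, ∀ y, ‖iteratedFDeriv ℝ j u y‖ ≤ δ) →
      ∀ j ≤ k, ∀ z : ℝ × E, z.1 ∈ Icc (0 : ℝ) 1 →
        ‖iteratedFDeriv ℝ j (fun z : ℝ × E => χ z.1 • u z.2) z‖ ≤ C * δ := by
  have hb : ∀ i : ℕ, ∃ B : ℝ, ∀ t ∈ Icc (0 : ℝ) 1, ‖iteratedFDeriv ℝ i χ t‖ ≤ B := fun i =>
    isCompact_Icc.exists_bound_of_continuousOn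
      (hχ.continuous_iteratedFDeriv (m := i) (mod_cast le_top)).continuousOn
  choose B hB using hb
  have hB0 : ∀ i, 0 ≤ B i := fun i => (norm_nonneg _).trans (hB i 0 (by simp))
  have hs0 : ∀ j : ℕ, 0 ≤ ∑ i ∈ Finset.range (j + 1), (j.choose i : ℝ) * B i := fun j =>
    Finset.sum_nonneg fun i _ => mul_nonneg (Nat.cast_nonneg _) (hB0 i)
  refine ⟨1 + ∑ j ∈ Finset.range (k + 1), ∑ i ∈ Finset.range (j + 1), (j.choose i : ℝ) * B i,
    by linarith [Finset.sum_nonneg fun j (_ : j ∈ Finset.range (k + 1)) => hs0 j], ?_⟩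
  intro u δ hu hδ j hj z hz
  have hδ0 : 0 ≤ δ := (norm_nonneg _).trans (hδ 0 (Nat.zero_le _) 0)
  have hfst : ∀ i, ‖iteratedFDeriv ℝ i (fun z : ℝ × E => χ z.1) z‖ ≤ B i := by
    intro i
    have h := (ContinuousLinearMap.fst ℝ ℝ E).iteratedFDeriv_comp_right hχ z
      (i := i) (mod_cast le_top)
    change ‖iteratedFDeriv ℝ i (χ ∘ ContinuousLinearMap.fst ℝ ℝ E) z‖ ≤ _
    rw [h]
    refine (ContinuousMultilinearMap.norm_compContinuousLinearMap_le _ _).trans ?_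
    refine (mul_le_of_le_one_right (norm_nonneg _) ?_).trans (hB i _ hz)
    exact Finset.prod_le_one (fun _ _ => norm_nonneg _)
      fun _ _ => ContinuousLinearMap.norm_fst_le ..
  have hsnd : ∀ i ≤ k, ‖iteratedFDeriv ℝ i (fun z : ℝ × E => u z.2) z‖ ≤ δ := by
    intro i hi
    have h := (ContinuousLinearMap.snd ℝ ℝ E).iteratedFDeriv_comp_right hu z
      (i := i) (mod_cast le_top)
    change ‖iteratedFDeriv ℝ i (u ∘ ContinuousLinearMap.snd ℝ ℝ E) z‖ ≤ _
    rw [h]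
    refine (ContinuousMultilinearMap.norm_compContinuousLinearMap_le _ _).trans ?_
    refine (mul_le_of_le_one_right (norm_nonneg _) ?_).trans (hδ i hi _)
    exact Finset.prod_le_one (fun _ _ => norm_nonneg _)
      fun _ _ => ContinuousLinearMap.norm_snd_le ..
  calc ‖iteratedFDeriv ℝ j (fun z : ℝ × E => χ z.1 • u z.2) z‖
      ≤ ∑ i ∈ Finset.range (j + 1), (j.choose i : ℝ) *
          ‖iteratedFDeriv ℝ i (fun z : ℝ × E => χ z.1) z‖ *
          ‖iteratedFDeriv ℝ (j - i) (fun z : ℝ × E => u z.2) z‖ :=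
        norm_iteratedFDeriv_smul_le (N := ∞) (hχ.comp contDiff_fst) (hu.comp contDiff_snd) z
          (mod_cast le_top)
    _ ≤ ∑ i ∈ Finset.range (j + 1), (j.choose i : ℝ) * B i * δ := by
        gcongr with i hi
        · exact mul_nonneg (Nat.cast_nonneg _) (hB0 i)
        · exact hfst i
        · exact hsnd _ (by lia)
    _ = (∑ i ∈ Finset.range (j + 1), (j.choose i : ℝ) * B i) * δ := by rw [Finset.sum_mul]
    _ ≤ _ := by
        gcongr
        have := Finset.single_le_sum
          (f := fun j : ℕ => ∑ i ∈ Finset.range (j + 1), (j.choose i : ℝ) * B i)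
          (fun j _ => hs0 j)
          (Finset.mem_range.2 (Nat.lt_succ_of_le hj))
        linarith

/-- A right inverse `H` of `id + v` has derivatives bounded by a universal constant as soon as the
derivatives of `v` are at most `1/2`. Differentiating the relation gives
`DH = id - (Dv ∘ H) DH`; in the Leibniz expansion of `Dᵏ` of the right-hand side, the only term
that contains `Dᵏ⁺¹H` has the coefficient `Dv ∘ H`, of norm at most `1/2`, and is absorbed by the
left-hand side. -/
theorem exists_norm_iteratedFDeriv_rightInverse_le (Z : Type*) [NormedAddCommGroup Z]
    [NormedSpace ℝ Z] (k : ℕ) :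
    ∃ M : ℝ, 1 ≤ M ∧ ∀ (v H : Z → Z) (z : Z), ContDiff ℝ ∞ v → ContDiff ℝ ∞ H →
      (∀ y, H y + v (H y) = y) → (∀ j ≤ k, ‖iteratedFDeriv ℝ j v (H z)‖ ≤ 1 / 2) →
      ∀ j, 1 ≤ j → j ≤ k → ‖iteratedFDeriv ℝ j H z‖ ≤ M := by
  induction k with
  | zero => exact ⟨1, le_rfl, fun _ _ _ _ _ _ _ j h1 h2 => by lia⟩
  | succ k ih =>
    obtain ⟨M, hM1, hM⟩ := ih
    set S : ℝ := ∑ i ∈ Finset.range k,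
      (k.choose (i + 1) : ℝ) * (((i + 1).factorial : ℝ) * (1 / 2) * M ^ (i + 1)) * M with hS
    have hS0 : 0 ≤ S := by positivity
    refine ⟨max M (2 * (1 + S)), le_max_of_le_left hM1, ?_⟩
    intro v H z hv hH hHv hvb j h1 hj
    have hMj := hM v H z hv hH hHv fun j hj => hvb j (hj.trans k.le_succ)
    rcases Nat.lt_succ_iff_lt_or_eq.1 (Nat.lt_succ_of_le hj) with hj' | rfl
    · exact (hMj j h1 (Nat.lt_succ_iff.1 hj')).trans (le_max_left _ _)
    refine le_max_of_le_right ?_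
    have hdv : ContDiff ℝ ∞ (fderiv ℝ v) := hv.fderiv_right (m := ∞) (by simp)
    have hdH : ContDiff ℝ ∞ (fderiv ℝ H) := hH.fderiv_right (m := ∞) (by simp)
    have hdvH : ContDiff ℝ ∞ (fun y => fderiv ℝ v (H y)) := hdv.comp hH
    set X : Z → Z →L[ℝ] Z := fun y =>
      ContinuousLinearMap.compL ℝ Z Z Z (fderiv ℝ v (H y)) (fderiv ℝ H y) with hX
    have hXs : ContDiff ℝ ∞ X := by
      simp only [hX, ContinuousLinearMap.compL_apply]
      exact hdvH.clm_comp hdH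
    have key : fderiv ℝ H = (fun _ => ContinuousLinearMap.id ℝ Z) - X := by
      funext y
      have hHd : HasFDerivAt H (fderiv ℝ H y) y :=
        (hH.differentiable (by simp) y).hasFDerivAt
      have hvd : HasFDerivAt v (fderiv ℝ v (H y)) (H y) :=
        (hv.differentiable (by simp) _).hasFDerivAt
      have h2 := hHd.add (hvd.comp y hHd)
      have h3 : (H + v ∘ H) = id := funext hHv
      rw [h3] at h2
      have := h2.unique (hasFDerivAt_id y)
      simp only [hX, Pi.sub_apply, ContinuousLinearMap.compL_apply]
      rw [← this]; abel
    have hconst : ‖iteratedFDeriv ℝ k (fun _ : Z => ContinuousLinearMap.id ℝ Z) z‖ ≤ 1 := by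
      rcases Nat.eq_zero_or_pos k with rfl | hk
      · simpa using ContinuousLinearMap.norm_id_le
      · rw [iteratedFDeriv_const_of_ne hk.ne']; simp
    have hXb : ‖iteratedFDeriv ℝ k X z‖ ≤ S + 1 / 2 * ‖iteratedFDeriv ℝ (k + 1) H z‖ := by
      have hb := (ContinuousLinearMap.compL ℝ Z Z Z).norm_iteratedFDeriv_le_of_bilinear_of_le_one
        hdvH hdH z (n := k) (mod_cast le_top) (ContinuousLinearMap.norm_compL_le ℝ Z Z Z)
      refine hb.trans ?_
      rw [Finset.sum_range_succ', hS]
      gcongr with i hi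
      · have hi' : i < k := Finset.mem_range.1 hi
        refine norm_iteratedFDeriv_comp_le hdv hH (mod_cast le_top) z (C := 1 / 2) (D := M) ?_ ?_
        · intro m hm
          rw [norm_iteratedFDeriv_fderiv]
          exact hvb _ (by lia)
        · intro m hm1 hm
          exact (hMj m hm1 (by lia)).trans (le_self_pow₀ hM1 (by lia))
      · have hi' : i < k := Finset.mem_range.1 hi
        rw [norm_iteratedFDeriv_fderiv]
        exact hMj _ (by lia) (by lia)
      · rw [Nat.choose_zero_right, Nat.cast_one, one_mul, norm_iteratedFDeriv_zero]
        have := hvb 1 (by lia)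
        rwa [← norm_iteratedFDeriv_fderiv, norm_iteratedFDeriv_zero] at this
      · rw [Nat.sub_zero, norm_iteratedFDeriv_fderiv]
    have hfin : ‖iteratedFDeriv ℝ (k + 1) H z‖ ≤
        1 + (S + 1 / 2 * ‖iteratedFDeriv ℝ (k + 1) H z‖) := by
      conv_lhs => rw [← norm_iteratedFDeriv_fderiv, key]
      rw [iteratedFDeriv_sub_apply contDiffAt_const (hXs.of_le (mod_cast le_top)).contDiffAt]
      exact (norm_sub_le _ _).trans (add_le_add hconst hXb)
    linarith

/-- The `C^k`-smallness of `u` is inherited by `(t, x) ↦ τ t • u (G (t, x))`, where `G (t, ·)`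
inverts `y ↦ y + σ t • u y`. In space-time, `(t, x) ↦ (t, G (t, x))` is a right inverse of
`id + v` with `v (t, y) = (0, σ t • u y)`. -/
theorem exists_norm_iteratedFDeriv_smul_comp_inverse_lt {σ τ : ℝ → ℝ} (hσ : ContDiff ℝ ∞ σ)
    (hτ : ContDiff ℝ ∞ τ) (k : ℕ) {ε : ℝ} (hε : 0 < ε) :
    ∃ δ : ℝ, 0 < δ ∧ ∀ (u : E → E) (G : ℝ × E → E), ContDiff ℝ ∞ u → ContDiff ℝ ∞ G →
      (∀ j ≤ k, ∀ y, ‖iteratedFDeriv ℝ j u y‖ ≤ δ) →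
      (∀ z, G z + σ z.1 • u (G z) = z.2) →
      ∀ j ≤ k, ∀ z : ℝ × E, z.1 ∈ Icc (0 : ℝ) 1 →
        ‖iteratedFDeriv ℝ j (fun z : ℝ × E => τ z.1 • u (G z)) z‖ < ε := by
  obtain ⟨C₁, hC₁, h₁⟩ := exists_norm_iteratedFDeriv_smul_snd_le (E := E) (F := ℝ × E) hσ k
  obtain ⟨C₂, hC₂, h₂⟩ := exists_norm_iteratedFDeriv_smul_snd_le (E := E) (F := E) hτ k
  obtain ⟨M, hM1, hM⟩ := exists_norm_iteratedFDeriv_rightInverse_le (ℝ × E) k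
  have hM0 : 0 < M := by linarith
  refine ⟨min (1 / 2 / C₁) (ε / 2 / (k.factorial * C₂ * M ^ k)), by positivity, ?_⟩
  intro u G hu hG hδ hGu j hj z hz
  set δ := min (1 / 2 / C₁) (ε / 2 / (k.factorial * C₂ * M ^ k))
  have hδ0 : 0 < δ := by positivity
  have hδ₁ : C₁ * δ ≤ 1 / 2 := by
    rw [mul_comm, ← le_div_iff₀ hC₁]; exact min_le_left _ _
  have hδ₂ : k.factorial * (C₂ * δ) * M ^ k ≤ ε / 2 := by
    have : δ * (k.factorial * C₂ * M ^ k) ≤ ε / 2 := by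
      rw [← le_div_iff₀ (by positivity)]; exact min_le_right _ _
    linarith
  set H : ℝ × E → ℝ × E := fun z => (z.1, G z)
  have hH : ContDiff ℝ ∞ H := contDiff_fst.prodMk hG
  set u' : E → ℝ × E := ContinuousLinearMap.inr ℝ ℝ E ∘ u
  have hu' : ContDiff ℝ ∞ u' := (ContinuousLinearMap.inr ℝ ℝ E).contDiff.comp hu
  have hu'δ : ∀ i ≤ k, ∀ y, ‖iteratedFDeriv ℝ i u' y‖ ≤ δ := fun i hi y =>
    ((ContinuousLinearMap.inr ℝ ℝ E).norm_iteratedFDeriv_comp_left (hu.contDiffAt (x := y))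
      (n := i) (mod_cast le_top)).trans ((mul_le_of_le_one_left (norm_nonneg _)
        (ContinuousLinearMap.norm_inr_le_one ℝ ℝ E)).trans (hδ i hi y))
  have hHb := hM (fun z => σ z.1 • u' z.2) H z
    ((hσ.comp contDiff_fst).smul (hu'.comp contDiff_snd)) hH
    (fun y => Prod.ext (by simp [H, u']) (by simpa [H, u'] using hGu y))
    (fun i hi => (h₁ u' δ hu' hu'δ i hi (H z) hz).trans hδ₁)
  have hcomp := norm_iteratedFDeriv_comp_le (g := fun z : ℝ × E => τ z.1 • u z.2) (f := H) (N := ∞)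
    ((hτ.comp contDiff_fst).smul (hu.comp contDiff_snd)) hH (n := j) (mod_cast le_top) z
    (C := C₂ * δ) (D := M) (fun i hi => h₂ u δ hu hδ i (hi.trans hj) (H z) hz)
    (fun i h1 hi => (hHb i h1 (hi.trans hj)).trans (le_self_pow₀ hM1 (by lia)))
  calc _ ≤ j.factorial * (C₂ * δ) * M ^ j := hcomp
    _ ≤ k.factorial * (C₂ * δ) * M ^ k := by gcongr
    _ ≤ ε / 2 := hδ₂
    _ < ε := half_lt_self hε

end Estimates

/-! ### Inverting small perturbations of the identity -/

section Inverse

variable {E : Type*} [NormedAddCommGroup E] [NormedSpace ℝ E]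

theorem lipschitzWith_half_of_norm_fderiv_le {u : E → E} (hu : ContDiff ℝ ∞ u)
    (hd : ∀ y, ‖fderiv ℝ u y‖ ≤ 1 / 2) : LipschitzWith (1 / 2) u :=
  lipschitzWith_of_nnnorm_fderiv_le (hu.differentiable (by simp)) fun y => by
    rw [← NNReal.coe_le_coe]; simpa using hd y

theorem injective_add_smul_of_lipschitzWith {u : E → E} (hu : LipschitzWith (1 / 2) u) {c : ℝ}
    (hc : |c| ≤ 1) : Function.Injective fun y => y + c • u y := by
  intro y y' h
  have h1 : y - y' = c • (u y' - u y) := by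
    simp only at h
    rw [smul_sub, sub_eq_sub_iff_add_eq_add, h]; abel
  have h2 : ‖y - y'‖ ≤ 1 / 2 * ‖y - y'‖ := by
    calc ‖y - y'‖ = |c| * ‖u y' - u y‖ := by rw [h1, norm_smul, Real.norm_eq_abs]
      _ ≤ 1 * ‖u y' - u y‖ := by gcongr
      _ ≤ 1 / 2 * ‖y - y'‖ := by
        rw [one_mul, norm_sub_rev]; simpa using hu.norm_sub_le y y'
  rw [← sub_eq_zero, ← norm_le_zero_iff]
  linarith

theorem surjective_add_smul_of_lipschitzWith [CompleteSpace E] {u : E → E}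
    (hu : LipschitzWith (1 / 2) u) {c : ℝ} (hc : |c| ≤ 1) :
    Function.Surjective fun y => y + c • u y := by
  intro x
  have hcon : ContractingWith (1 / 2) fun y => x - c • u y := by
    refine ⟨by rw [← NNReal.coe_lt_coe]; norm_num, LipschitzWith.of_dist_le_mul fun y y' => ?_⟩
    rw [dist_sub_left, dist_eq_norm, ← smul_sub, norm_smul, Real.norm_eq_abs]
    calc |c| * ‖u y - u y'‖ ≤ 1 * ‖u y - u y'‖ := by gcongr
      _ ≤ _ := by rw [one_mul, ← dist_eq_norm]; exact hu.dist_le_mul y y'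
  refine ⟨hcon.fixedPoint, ?_⟩
  have h : x - c • u hcon.fixedPoint = hcon.fixedPoint := hcon.fixedPoint_isFixedPt
  exact (sub_eq_iff_eq_add.1 h).symm

/-- A right inverse of an injective smooth map with everywhere invertible derivative is smooth:
by injectivity, it agrees with the local inverses given by the inverse function theorem. -/
theorem contDiff_rightInverse_of_injective {Z : Type*} [NormedAddCommGroup Z] [NormedSpace ℝ Z]
    [FiniteDimensional ℝ Z] {f g : Z → Z} (hf : ContDiff ℝ ∞ f) (hinj : Function.Injective f)
    (hd : ∀ z, Function.Injective (fderiv ℝ f z)) (hg : ∀ z, f (g z) = z) :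
    ContDiff ℝ ∞ g := by
  have : CompleteSpace Z := FiniteDimensional.complete ℝ Z
  rw [contDiff_iff_contDiffAt]
  intro z
  let L : Z ≃L[ℝ] Z :=
    (LinearEquiv.ofInjectiveEndo (fderiv ℝ f (g z) : Z →ₗ[ℝ] Z) (hd (g z))).toContinuousLinearEquiv
  have hL : (L : Z →L[ℝ] Z) = fderiv ℝ f (g z) := by ext w; rfl
  have hfd : HasFDerivAt f (L : Z →L[ℝ] Z) (g z) := by
    rw [hL]; exact (hf.differentiable (by simp) _).hasFDerivAt
  have hfa : ContDiffAt ℝ ∞ f (g z) := hf.contDiffAt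
  have hs := hfa.hasStrictFDerivAt' hfd (by simp)
  have hloc := hfa.to_localInverse hfd (by simp)
  have hev := hs.eventually_right_inverse
  rw [hg] at hloc hev
  refine hloc.congr_of_eventuallyEq ?_
  filter_upwards [hev] with w hw
  exact hinj ((hg w).trans hw.symm)

/-- The maps `y ↦ y + σ t • u y` have inverses `G (t, ·)` that depend smoothly on `t` as well. -/
theorem exists_contDiff_inverse_add_smul [FiniteDimensional ℝ E] {u : E → E} {σ : ℝ → ℝ}
    (hu : ContDiff ℝ ∞ u) (hd : ∀ y, ‖fderiv ℝ u y‖ ≤ 1 / 2) (hσ : ContDiff ℝ ∞ σ)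
    (hσ1 : ∀ t, |σ t| ≤ 1) :
    ∃ G : ℝ × E → E, ContDiff ℝ ∞ G ∧ (∀ t x, G (t, x) + σ t • u (G (t, x)) = x) ∧
      ∀ t y, G (t, y + σ t • u y) = y := by
  have : CompleteSpace E := FiniteDimensional.complete ℝ E
  have hlip := lipschitzWith_half_of_norm_fderiv_le hu hd
  choose g hg using fun t => surjective_add_smul_of_lipschitzWith hlip (hσ1 t)
  simp only at hg
  have hinj := fun t => injective_add_smul_of_lipschitzWith hlip (hσ1 t)
  refine ⟨fun z => g z.1 z.2, ?_, hg, fun t y => hinj t (hg t _)⟩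
  let f : ℝ × E → ℝ × E := fun z => (z.1, z.2 + σ z.1 • u z.2)
  have hf : ContDiff ℝ ∞ f := by fun_prop
  have hfinj : Function.Injective f := by
    rintro ⟨t, y⟩ ⟨t', y'⟩ h
    obtain ⟨h1, h2⟩ := Prod.mk.inj h
    change t = t' at h1
    subst h1
    exact Prod.ext rfl (hinj t h2)
  have hfd : ∀ z, Function.Injective (fderiv ℝ f z) := by
    intro z
    have hud : HasFDerivAt (fun z : ℝ × E => u z.2)
        ((fderiv ℝ u z.2).comp (ContinuousLinearMap.snd ℝ ℝ E)) z :=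
      ((hu.differentiable (by simp) z.2).hasFDerivAt).comp z hasFDerivAt_snd
    have hσd : HasFDerivAt (fun z : ℝ × E => σ z.1)
        ((fderiv ℝ σ z.1).comp (ContinuousLinearMap.fst ℝ ℝ E)) z :=
      ((hσ.differentiable (by simp) z.1).hasFDerivAt).comp z hasFDerivAt_fst
    have hder : HasFDerivAt f _ z :=
      hasFDerivAt_fst.prodMk (hasFDerivAt_snd.add (hσd.smul hud))
    rw [hder.fderiv, injective_iff_map_eq_zero]
    rintro ⟨τ, η⟩ h
    obtain ⟨h1, h2⟩ := Prod.mk.inj h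
    change τ = 0 at h1
    subst h1
    change η + (σ z.1 • fderiv ℝ u z.2 η + fderiv ℝ σ z.1 0 • u z.2) = 0 at h2
    rw [map_zero, zero_smul, add_zero] at h2
    have h3 : ‖η‖ ≤ 1 / 2 * ‖η‖ := by
      calc ‖η‖ = |σ z.1| * ‖fderiv ℝ u z.2 η‖ := by
            rw [← Real.norm_eq_abs, ← norm_smul, eq_neg_of_add_eq_zero_right h2, norm_neg]
        _ ≤ 1 * (1 / 2 * ‖η‖) := by
            gcongr
            · exact hσ1 _
            · exact (fderiv ℝ u z.2).le_of_opNorm_le (hd _) η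
        _ = _ := one_mul _
    have h4 : η = 0 := norm_le_zero_iff.1 (by linarith)
    rw [h4]; rfl
  have := contDiff_rightInverse_of_injective (f := f) (g := fun z => (z.1, g z.1 z.2)) hf hfinj hfd
    fun z => Prod.ext rfl (hg z.1 z.2)
  exact contDiff_snd.comp this

/-- A map `y ↦ y + c • u y` with `u` small and supported in `D` preserves `D`. -/
theorem add_smul_mem_iff_of_lipschitzWith {u : E → E} (hu : LipschitzWith (1 / 2) u) {c : ℝ}
    (hc : |c| ≤ 1) {D : Set E} (h0 : ∀ y ∉ D, u y = 0) (y : E) : y + c • u y ∈ D ↔ y ∈ D := by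
  have hout : ∀ z ∉ D, z + c • u z = z := fun z hz => by rw [h0 z hz, smul_zero, add_zero]
  refine ⟨fun h => ?_, fun h => ?_⟩ <;> by_contra hn
  · exact hn (hout y hn ▸ h)
  · have heq : y + c • u y = y := injective_add_smul_of_lipschitzWith hu hc (hout _ hn)
    exact hn (heq.symm ▸ h)

end Inverse

/-! ### The symplectic form -/

section Symplectic

variable {n : ℕ}

theorem stdSymplecticForm_add_smul (a b p q : PhaseSpace n) (c : ℝ) :
    stdSymplecticForm (a + c • p) (b + c • q) = stdSymplecticForm a b +
      c * (stdSymplecticForm a q + stdSymplecticForm p b) + c ^ 2 * stdSymplecticForm p q := by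
  simp only [stdSymplecticForm, PiLp.add_apply, PiLp.smul_apply, smul_eq_mul,
    ← Finset.sum_add_distrib, Finset.mul_sum]
  exact Finset.sum_congr rfl fun i _ => by ring

/-- If `p = A a` and `q = A b` with `id + A` symplectic, then `ω (a, q) + ω (p, b) = -ω (p, q)`,
so that `id + c A` pulls `ω` back to `ω - c (1 - c) ω (A ·, A ·)`, which is symmetric under
`c ↔ 1 - c`. -/
theorem stdSymplecticForm_add_one_sub_smul {a b p q : PhaseSpace n}
    (h : stdSymplecticForm (a + p) (b + q) = stdSymplecticForm a b) (c : ℝ) :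
    stdSymplecticForm (a + (1 - c) • p) (b + (1 - c) • q) =
      stdSymplecticForm (a + c • p) (b + c • q) := by
  have h1 := stdSymplecticForm_add_smul a b p q 1
  rw [one_smul, one_smul, h] at h1
  rw [stdSymplecticForm_add_smul, stdSymplecticForm_add_smul]
  linear_combination (2 * c - 1) * h1

theorem uniqueDiffOn_unitDisc : UniqueDiffOn ℝ (unitDisc n) :=
  uniqueDiffOn_convex (convex_closedBall 0 1)
    ⟨0, ball_subset_interior_closedBall (mem_ball_self one_pos)⟩

/-- For `u` small, supported in the disc and with `id + u` symplectic, and for `c ∈ [0, 1]`, the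
map `(id + (1 - c) u) ∘ (id + c u)⁻¹` is a symplectomorphism of the disc. Here `g` and `g'` are
the inverses of `id + c u` and `id + (1 - c) u`. -/
theorem isDiscSymplectomorphism_of_inverses {u g g' : PhaseSpace n → PhaseSpace n}
    (hu : ContDiff ℝ ∞ u) (hd : ∀ y, ‖fderiv ℝ u y‖ ≤ 1 / 2) (h0 : ∀ y ∉ unitDisc n, u y = 0)
    (hsymp : ∀ y ∈ unitDisc n, ∀ v w, stdSymplecticForm (v + fderiv ℝ u y v)
      (w + fderiv ℝ u y w) = stdSymplecticForm v w) {c : ℝ} (hc : c ∈ Icc (0 : ℝ) 1)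
    (hg : ContDiff ℝ ∞ g) (hgr : ∀ x, g x + c • u (g x) = x) (hgl : ∀ y, g (y + c • u y) = y)
    (hg' : ContDiff ℝ ∞ g') (hgr' : ∀ x, g' x + (1 - c) • u (g' x) = x)
    (hgl' : ∀ y, g' (y + (1 - c) • u y) = y) :
    IsDiscSymplectomorphism fun x => g x + (1 - c) • u (g x) := by
  have hlip := lipschitzWith_half_of_norm_fderiv_le hu hd
  have hc1 : |c| ≤ 1 := abs_le.2 ⟨by linarith [hc.1], hc.2⟩
  have hc1' : |1 - c| ≤ 1 := abs_le.2 ⟨by linarith [hc.2], by linarith [hc.1]⟩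
  have hD := add_smul_mem_iff_of_lipschitzWith hlip hc1 h0
  have hD' := add_smul_mem_iff_of_lipschitzWith hlip hc1' h0
  have hgD : ∀ x ∈ unitDisc n, g x ∈ unitDisc n := fun x hx => (hD _).1 (by rwa [hgr])
  have hgD' : ∀ x ∈ unitDisc n, g' x ∈ unitDisc n := fun x hx => (hD' _).1 (by rwa [hgr'])
  have hφ : ContDiff ℝ ∞ fun x => g x + (1 - c) • u (g x) :=
    hg.add ((hu.comp hg).const_smul (1 - c))
  refine ⟨fun x hx => (hD' _).2 (hgD x hx), hφ.contDiffOn,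
    ⟨fun x => g' x + c • u (g' x), fun x hx => (hD _).2 (hgD' x hx), ⟨?_, ?_⟩,
      (hg'.add ((hu.comp hg').const_smul c)).contDiffOn⟩, ?_⟩
  · intro x _
    simp only [hgl', hgr]
  · intro x _
    simp only [hgl, hgr']
  · intro x hx v w
    rw [(hφ.differentiable (by simp) x).fderivWithin (uniqueDiffOn_unitDisc x hx)]
    have hgd := (hg.differentiable (by simp) x).hasFDerivAt
    have hud := (hu.differentiable (by simp) (g x)).hasFDerivAt
    have hF : ∀ e : ℝ, HasFDerivAt (fun x => g x + e • u (g x))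
        (fderiv ℝ g x + e • (fderiv ℝ u (g x)).comp (fderiv ℝ g x)) x := fun e =>
      hgd.add ((hud.comp x hgd).const_smul e)
    have hid : ∀ v, fderiv ℝ g x v + c • fderiv ℝ u (g x) (fderiv ℝ g x v) = v := by
      intro v
      have h := hF c
      rw [funext hgr] at h
      exact DFunLike.congr_fun (h.unique (hasFDerivAt_id x)) v
    rw [(hF (1 - c)).fderiv]
    change stdSymplecticForm
      (fderiv ℝ g x v + (1 - c) • fderiv ℝ u (g x) (fderiv ℝ g x v))
      (fderiv ℝ g x w + (1 - c) • fderiv ℝ u (g x) (fderiv ℝ g x w)) = _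
    rw [stdSymplecticForm_add_one_sub_smul (hsymp _ (hgD x hx) _ _), hid, hid]

end Symplectic

/-! ### The displacement of a disc map -/

section Displacement

variable {n : ℕ}

/-- The displacement `φ - id` of a map of the disc, extended by zero. -/
noncomputable def discDisplacement (φ : PhaseSpace n → PhaseSpace n) : PhaseSpace n → PhaseSpace n :=
  (unitDisc n).indicator fun x => φ x - x

variable {φ : PhaseSpace n → PhaseSpace n}

theorem discDisplacement_of_mem {x : PhaseSpace n} (hx : x ∈ unitDisc n) :
    discDisplacement φ x = φ x - x :=
  indicator_of_mem hx _

theorem discDisplacement_of_notMem {x : PhaseSpace n} (hx : x ∉ unitDisc n) :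
    discDisplacement φ x = 0 :=
  indicator_of_notMem hx _

theorem discDisplacement_eventuallyEq_zero {x : PhaseSpace n} (hx : x ∉ unitDisc n) :
    discDisplacement φ =ᶠ[𝓝 x] fun _ => 0 := by
  filter_upwards [isClosed_closedBall.isOpen_compl.mem_nhds hx] with y hy
  exact discDisplacement_of_notMem hy

theorem contDiff_discDisplacement (hφ : ContDiffOn ℝ ∞ φ (unitDisc n)) {U : Set (PhaseSpace n)}
    (hU : IsOpen U) (hbU : unitDiscBoundary n ⊆ U) (hφU : ∀ x ∈ U ∩ unitDisc n, φ x = x) :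
    ContDiff ℝ ∞ (discDisplacement φ) := by
  rw [contDiff_iff_contDiffAt]
  intro x
  by_cases hx : x ∈ unitDisc n
  · rcases (mem_closedBall.1 hx).lt_or_eq with h | h
    · have hn : unitDisc n ∈ 𝓝 x := closedBall_mem_nhds_of_mem (mem_ball.2 h)
      refine ((hφ.contDiffAt hn).sub contDiffAt_id).congr_of_eventuallyEq ?_
      filter_upwards [hn] with y hy using discDisplacement_of_mem hy
    · refine (contDiffAt_const (c := 0)).congr_of_eventuallyEq ?_
      filter_upwards [hU.mem_nhds (hbU (mem_sphere.2 h))] with y hy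
      by_cases hyD : y ∈ unitDisc n
      · rw [discDisplacement_of_mem hyD, hφU y ⟨hy, hyD⟩, sub_self]
      · exact discDisplacement_of_notMem hyD
  · exact contDiffAt_const.congr_of_eventuallyEq (discDisplacement_eventuallyEq_zero hx)

theorem norm_iteratedFDeriv_discDisplacement_le (hu : ContDiff ℝ ∞ (discDisplacement φ))
    {l : ℕ} {δ : ℝ} (hδ : 0 ≤ δ) (h : CkClose l δ (unitDisc n) φ fun x => x) {j : ℕ} (hj : j ≤ l)
    (y : PhaseSpace n) : ‖iteratedFDeriv ℝ j (discDisplacement φ) y‖ ≤ δ := by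
  by_cases hy : y ∈ unitDisc n
  · rw [← iteratedFDerivWithin_eq_iteratedFDeriv uniqueDiffOn_unitDisc
      (hu.of_le (mod_cast le_top)).contDiffAt hy,
      iteratedFDerivWithin_congr (fun x hx => discDisplacement_of_mem hx) hy]
    exact (h j hj y hy).le
  · have h0 := (discDisplacement_eventuallyEq_zero (φ := φ) hy).iteratedFDeriv ℝ j
    rw [h0.eq_of_nhds, iteratedFDeriv_fun_zero]
    simpa using hδ

theorem stdSymplecticForm_add_fderiv_discDisplacement (hφ : IsDiscSymplectomorphism φ)
    (hu : ContDiff ℝ ∞ (discDisplacement φ)) {y : PhaseSpace n} (hy : y ∈ unitDisc n)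
    (v w : PhaseSpace n) :
    stdSymplecticForm (v + fderiv ℝ (discDisplacement φ) y v)
      (w + fderiv ℝ (discDisplacement φ) y w) = stdSymplecticForm v w := by
  have hadd : HasFDerivAt (fun x => x + discDisplacement φ x)
      (ContinuousLinearMap.id ℝ _ + fderiv ℝ (discDisplacement φ) y) y :=
    (hasFDerivAt_id y).add (hu.differentiable (by simp) y).hasFDerivAt
  have hwithin : HasFDerivWithinAt φ
      (ContinuousLinearMap.id ℝ _ + fderiv ℝ (discDisplacement φ) y) (unitDisc n) y :=
    HasFDerivWithinAt.congr hadd.hasFDerivWithinAt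
      (fun x hx => by rw [discDisplacement_of_mem hx, add_sub_cancel])
      (by rw [discDisplacement_of_mem hy, add_sub_cancel])
  have h := hφ.preserves_form y hy v w
  rw [hwithin.fderivWithin (uniqueDiffOn_unitDisc y hy)] at h
  exact h

end Displacement

/-! ### The contraction -/

theorem mainTheorem4 (n : ℕ) (hn : 1 ≤ n) :
    -- for every basic neighbourhood of the trivial family in `C^∞([0,1] × D²ⁿ)`
    ∀ (k : ℕ) (ε : ℝ), 0 < ε →
    -- there is a basic neighbourhood of the identity in `C^∞(D²ⁿ)`
    ∃ (l : ℕ) (δ : ℝ), 0 < δ ∧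
      ∀ φ₀ : PhaseSpace n → PhaseSpace n,
        IsDiscSymplectomorphism φ₀ →
        (∃ U : Set (PhaseSpace n), IsOpen U ∧ unitDiscBoundary n ⊆ U ∧
          ∀ x ∈ U ∩ unitDisc n, φ₀ x = x) →
        CkClose l δ (unitDisc n) φ₀ (fun x => x) →
        ∃ φ : ℝ → PhaseSpace n → PhaseSpace n,
          ContDiffOn ℝ ∞ (fun z : ℝ × PhaseSpace n => φ z.1 z.2) (Icc (0 : ℝ) 1 ×ˢ unitDisc n) ∧
          (∀ t ∈ Icc (0 : ℝ) 1, IsDiscSymplectomorphism (φ t)) ∧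
          (∃ V : Set (PhaseSpace n), IsOpen V ∧ unitDiscBoundary n ⊆ V ∧
            ∀ t ∈ Icc (0 : ℝ) 1, ∀ x ∈ V ∩ unitDisc n, φ t x = x) ∧
          (∀ t ∈ Icc (0 : ℝ) (1 / 3), ∀ x ∈ unitDisc n, φ t x = φ₀ x) ∧
          (∀ t ∈ Icc (2 / 3 : ℝ) 1, ∀ x ∈ unitDisc n, φ t x = x) ∧
          CkClose k ε (Icc (0 : ℝ) 1 ×ˢ unitDisc n)
            (fun z : ℝ × PhaseSpace n => φ z.1 z.2) (fun z => z.2) := by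
  intro k ε hε
  -- The parameter runs from `0`, where the map is `φ₀`, to `1 / 2`, where it is the identity.
  let σ : ℝ → ℝ := fun t => Real.smoothTransition (3 * t - 1) / 2
  have hσ : ContDiff ℝ ∞ σ := by
    have : ContDiff ℝ ∞ fun t : ℝ => 3 * t - 1 := by fun_prop
    exact (Real.smoothTransition.contDiff.comp this).div_const 2
  have hσ' : ContDiff ℝ ∞ fun t => 1 - σ t := contDiff_const.sub hσ
  have hτ : ContDiff ℝ ∞ fun t => 1 - 2 * σ t := contDiff_const.sub (contDiff_const.mul hσ)
  have hσI : ∀ t, σ t ∈ Icc (0 : ℝ) 1 := fun t =>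
    ⟨by have := Real.smoothTransition.nonneg (3 * t - 1); simp only [σ]; linarith,
      by have := Real.smoothTransition.le_one (3 * t - 1); simp only [σ]; linarith⟩
  obtain ⟨δ, hδ0, hδ⟩ :=
    exists_norm_iteratedFDeriv_smul_comp_inverse_lt (E := PhaseSpace n) hσ hτ k hε
  -- One more derivative than `k`, so that the first derivative is small even for `k = 0`.
  refine ⟨k + 1, min δ (1 / 2), by positivity, ?_⟩
  intro φ₀ hφ₀ ⟨U, hU, hbU, hφU⟩ hclose
  set u := discDisplacement φ₀
  have hu : ContDiff ℝ ∞ u := contDiff_discDisplacement hφ₀.contDiffOn hU hbU hφU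
  have hub : ∀ j ≤ k + 1, ∀ y, ‖iteratedFDeriv ℝ j u y‖ ≤ min δ (1 / 2) := fun j hj y =>
    norm_iteratedFDeriv_discDisplacement_le hu (by positivity) hclose hj y
  have hd : ∀ y, ‖fderiv ℝ u y‖ ≤ 1 / 2 := by
    intro y
    have := hub 1 (by lia) y
    rw [← norm_iteratedFDeriv_fderiv, norm_iteratedFDeriv_zero] at this
    exact this.trans (min_le_right _ _)
  obtain ⟨G, hG, hGr, hGl⟩ := exists_contDiff_inverse_add_smul hu hd hσ fun t =>
    abs_le.2 ⟨by linarith [(hσI t).1], (hσI t).2⟩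
  obtain ⟨G', hG', hGr', hGl'⟩ := exists_contDiff_inverse_add_smul hu hd hσ' fun t =>
    abs_le.2 ⟨by linarith [(hσI t).2], by linarith [(hσI t).1]⟩
  have hφ : ContDiff ℝ ∞ fun z : ℝ × PhaseSpace n => G z + (1 - σ z.1) • u (G z) :=
    hG.add ((hσ'.comp contDiff_fst).smul (hu.comp hG))
  have hpair : ∀ t : ℝ, ContDiff ℝ ∞ fun x : PhaseSpace n => (t, x) := fun t =>
    contDiff_const.prodMk contDiff_id
  refine ⟨fun t x => G (t, x) + (1 - σ t) • u (G (t, x)), hφ.contDiffOn, fun t _ => ?_,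
    ⟨U, hU, hbU, fun t _ x hx => ?_⟩, fun t ht x hx => ?_, fun t ht x _ => ?_, ?_⟩
  · exact isDiscSymplectomorphism_of_inverses hu hd (fun y hy => discDisplacement_of_notMem hy)
      (fun y hy => stdSymplecticForm_add_fderiv_discDisplacement hφ₀ hu hy) (hσI t)
      (hG.comp (hpair t)) (hGr t) (hGl t) (hG'.comp (hpair t)) (hGr' t) (hGl' t)
  · have hux : u x = 0 := by
      rw [show u x = φ₀ x - x from discDisplacement_of_mem hx.2, hφU x hx, sub_self]
    have hGx : G (t, x) = x := by simpa [hux] using hGl t x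
    simp only [hGx, hux, smul_zero, add_zero]
  · have h0 : σ t = 0 := by
      simp only [σ]
      rw [Real.smoothTransition.zero_of_nonpos (by linarith [ht.2]), zero_div]
    have hGx : G (t, x) = x := by simpa [h0] using hGr t x
    simp only [hGx, h0, sub_zero, one_smul]
    rw [show u x = φ₀ x - x from discDisplacement_of_mem hx, add_sub_cancel]
  · have h1 : 1 - σ t = σ t := by
      simp only [σ]
      rw [Real.smoothTransition.one_of_one_le (by linarith [ht.1])]
      norm_num
    simp only [h1, hGr]
  · intro j hj z hz
    have hdiff : (fun z : ℝ × PhaseSpace n => G (z.1, z.2) + (1 - σ z.1) • u (G (z.1, z.2)) - z.2) =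
        fun z => (1 - 2 * σ z.1) • u (G z) := by
      funext z
      nth_rewrite 3 [← hGr z.1 z.2]
      module
    have hs : UniqueDiffOn ℝ (Icc (0 : ℝ) 1 ×ˢ unitDisc n) :=
      (uniqueDiffOn_Icc zero_lt_one).prod uniqueDiffOn_unitDisc
    have hsm : ContDiff ℝ ∞ fun z : ℝ × PhaseSpace n => (1 - 2 * σ z.1) • u (G z) :=
      (hτ.comp contDiff_fst).smul (hu.comp hG)
    rw [hdiff, iteratedFDerivWithin_eq_iteratedFDeriv hs
      (hsm.of_le (mod_cast le_top)).contDiffAt hz]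
    exact hδ u G hu hG (fun i hi y => (hub i (by lia) y).trans (min_le_left _ _))
      (fun z => hGr z.1 z.2) j hj z hz.1
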